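/- Let $T>0$, $a_0,x_T\in\mathbb R$, $a_1\neq 0$, $d_1<d_2$, $D=(d_1,d_2)$, and write $\alpha=a_0/a_1$. For $\varepsilon>0$, $x\in D$, $s\in[0,T)$ let $x^\varepsilon=(x^\varepsilon_t)_{t\in[s,T]}$ be the Ornstein--Uhlenbeck bridge, i.e. the continuous process on $[s,T]$ with $$\mathrm d x^\varepsilon_t=b(x^\varepsilon_t,t)\,\mathrm dt+\sqrt\varepsilon\,\mathrm dw_t\quad(s<t<T),\qquad x^\varepsilon_s=x,\qquad b(x,t)=a_1\,\frac{(x_T+\alpha)-(x+\alpha)\cosh(a_1(T-t))}{\sinh(a_1(T-t))},$$ where $w$ is a standard Brownian motion. Let $\tau^\varepsilon_{x,s}=\inf\{t>s: x^\varepsilon_t\notin D\}$ and $q^\varepsilon(x,s)=\mathbb P^\varepsilon_{x,s}(\tau^\varepsilon_{x,s}\le T)$. First let $x_T>d_2$. Call Case $\mathrm{A}_{VII,III}$ the case in which $x_T>d_2>d_1>-\alpha$ and $d_1+\alpha>(x_T+\alpha)/\cosh(a_1T)$. In that case there is a unique $t_2\in(0,T)$ with $d_1+\alpha=(x_T+\alpha)/\cosh(a_1(T-t_2))$.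 Put $x^{0,*}(t)=(d_1+\alpha)\cosh(a_1(t_2-t))-\alpha$ (the solution of $\dot y=b(y,t)$ through $(d_1,t_2)$), $\Omega=\{(x,s):1/\cosh(a_1(T-s))<(x+\alpha)/(x_T+\alpha)<\cosh(a_1(T-s))\}$, let $\Sigma_1$ (resp. $\Sigma_2$) be the set of $(x,s)\in (D\times[0,T))\cap\Omega$ with $x<x^{0,*}(s)$ (resp. $x=x^{0,*}(s)$), and $\Sigma_3=(D\times[0,T))\setminus(\Sigma_1\cup\Sigma_2)$. (a) If $x_T>d_2$ and Case $\mathrm{A}_{VII,III}$ does not hold, then for every integer $m\ge0$, $q^\varepsilon(x,s)=1+o(\varepsilon^m)$ as $\varepsilon\to0$, uniformly on compact subsets of $D\times[0,T)$. (b) In Case $\mathrm{A}_{VII,III}$, for every integer $m\ge0$, $q^\varepsilon(x,s)=1+o(\varepsilon^m)$ as $\varepsilon\to0$, uniformly on compact subsets of $\Sigma_1\cup\Sigma_3$. (c) If $x_T<d_1$, the statements corresponding to (a) and (b) under the reflection $x\mapsto-x$ (which replaces $a_0,x_T,d_1,d_2$ by $-a_0,-x_T,-d_2,-d_1$) hold.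 (d) Moreover, whenever $x_T\notin D$ (in particular in all of the cases above), $q^\varepsilon(x,s)=1$ for all $\varepsilon>0$ and all $(x,s)\in D\times[0,T)$. -/

import Mathlib

open MeasureTheory ProbabilityTheory Set Filter Topology
open scoped NNReal

noncomputable section

/-- The data of the exit problem: coefficients `a₀, a₁`, horizon `T`, terminal point `xT`, and the
endpoints of the interval `D = (d₁, d₂)`. -/
structure OUData where
  a₀ : ℝ
  a₁ : ℝ
  T : ℝ
  xT : ℝ
  d₁ : ℝ
  d₂ : ℝ

namespace OUData

variable (p : OUData)

/-- The interval `D = (d₁, d₂)`. -/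
def D : Set ℝ := Ioo p.d₁ p.d₂

/-- The space-time domain `D × [0, T)`. -/
def domain : Set (ℝ × ℝ) := p.D ×ˢ Ico 0 p.T

/-- The drift of the Ornstein-Uhlenbeck bridge. -/
def drift (x t : ℝ) : ℝ :=
  p.a₁ * (((p.xT + p.a₀ / p.a₁) - (x + p.a₀ / p.a₁) * Real.cosh (p.a₁ * (p.T - t)))
    / Real.sinh (p.a₁ * (p.T - t)))

/-- `X` is, under `P`, an Ornstein-Uhlenbeck bridge on `[s, T]` with noise intensity `ε` started
from `x` at time `s`: a continuous process on `[s, T]` which on `[s, T)` solves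
`dX = b(X, t) dt + √ε dW`, `X_s = x`, for a standard Brownian motion `W`.
(The noise is additive, so the stochastic differential equation is a pathwise integral equation.
The terminal value `X_T = xT` a.s. is a consequence, and is not imposed.) -/
structure IsBridge (ε x s : ℝ) {Ω : Type*} [MeasurableSpace Ω] (P : Measure Ω)
    (W : ℝ≥0 → Ω → ℝ) (X : ℝ → Ω → ℝ) : Prop where
  brownian : IsBrownianReal W P
  aemeasurable : ∀ t ∈ Icc s p.T, AEMeasurable (X t) P
  continuous_paths : ∀ᵐ ω ∂P, ContinuousOn (fun t => X t ω) (Icc s p.T)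
  sde : ∀ᵐ ω ∂P, ∀ t ∈ Ico s p.T,
    X t ω = x + (∫ u in s..t, p.drift (X u ω) u)
      + √ε * (W t.toNNReal ω - W s.toNNReal ω)

/-- The first exit time `τ = inf {t > s : X_t ∉ D}` of a process indexed by `[s, T]`
(`τ = ⊤` if there is no such `t`). -/
def exitTime (s : ℝ) {Ω : Type*} (X : ℝ → Ω → ℝ) (ω : Ω) : EReal :=
  sInf ((fun t : ℝ => (t : EReal)) '' {t : ℝ | s < t ∧ t ≤ p.T ∧ X t ω ∉ p.D})

/-- The exit time probability `P (τ ≤ T)`. -/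
def exitProb (s : ℝ) {Ω : Type*} [MeasurableSpace Ω] (P : Measure Ω) (X : ℝ → Ω → ℝ) : ℝ :=
  P.real {ω | p.exitTime s X ω ≤ (p.T : EReal)}

/-! The subcases of `xT > d₂ > d₁`. -/

def CaseAI : Prop := -p.a₀ / p.a₁ > p.xT ∧ p.xT > p.d₂ ∧ p.d₂ > p.d₁

def CaseAII : Prop := -p.a₀ / p.a₁ = p.xT ∧ p.xT > p.d₂ ∧ p.d₂ > p.d₁

def CaseAIII : Prop := p.xT > -p.a₀ / p.a₁ ∧ -p.a₀ / p.a₁ > p.d₂ ∧ p.d₂ > p.d₁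

def CaseAIV : Prop := p.xT > -p.a₀ / p.a₁ ∧ -p.a₀ / p.a₁ = p.d₂ ∧ p.d₂ > p.d₁

def CaseAV : Prop := p.xT > p.d₂ ∧ p.d₂ > -p.a₀ / p.a₁ ∧ -p.a₀ / p.a₁ > p.d₁

def CaseAVI : Prop := p.xT > p.d₂ ∧ p.d₂ > -p.a₀ / p.a₁ ∧ -p.a₀ / p.a₁ = p.d₁

def CaseAVII : Prop := p.xT > p.d₂ ∧ p.d₂ > p.d₁ ∧ p.d₁ > -p.a₀ / p.a₁

def CaseAVIISubI : Prop :=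
  p.CaseAVII ∧ p.d₂ + p.a₀ / p.a₁ ≤ (p.xT + p.a₀ / p.a₁) / Real.cosh (p.a₁ * p.T)

def CaseAVIISubII : Prop :=
  p.CaseAVII ∧ p.d₂ + p.a₀ / p.a₁ > (p.xT + p.a₀ / p.a₁) / Real.cosh (p.a₁ * p.T)
    ∧ p.d₁ + p.a₀ / p.a₁ ≤ (p.xT + p.a₀ / p.a₁) / Real.cosh (p.a₁ * p.T)

def CaseAVIISubIII : Prop :=
  p.CaseAVII ∧ p.d₁ + p.a₀ / p.a₁ > (p.xT + p.a₀ / p.a₁) / Real.cosh (p.a₁ * p.T)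

/-- Any of the subcases other than `CaseAVIISubIII`. -/
def CaseARegular : Prop :=
  p.CaseAI ∨ p.CaseAII ∨ p.CaseAIII ∨ p.CaseAIV ∨ p.CaseAV ∨ p.CaseAVI
    ∨ p.CaseAVIISubI ∨ p.CaseAVIISubII

/-- The region of the starting points of non-monotone deterministic trajectories. -/
def nonmonotoneRegion : Set (ℝ × ℝ) :=
  {z | 1 / Real.cosh (p.a₁ * (p.T - z.2)) < (z.1 + p.a₀ / p.a₁) / (p.xT + p.a₀ / p.a₁)
    ∧ (z.1 + p.a₀ / p.a₁) / (p.xT + p.a₀ / p.a₁) < Real.cosh (p.a₁ * (p.T - z.2))}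

/-- `t₂ ∈ (0, T)` is the time at which the nullcline of the drift meets `d₁`. -/
def IsTangencyTime (t₂ : ℝ) : Prop :=
  t₂ ∈ Ioo 0 p.T ∧
    p.d₁ + p.a₀ / p.a₁ = (p.xT + p.a₀ / p.a₁) / Real.cosh (p.a₁ * (p.T - t₂))

/-- The solution `x⁰_{x,s}` of the noiseless equation, at time `t`. -/
def detPath (x s t : ℝ) : ℝ :=
  (x + p.a₀ / p.a₁) * (Real.sinh (p.a₁ * (p.T - t)) / Real.sinh (p.a₁ * (p.T - s)))
    + (p.xT + p.a₀ / p.a₁) * (Real.sinh (p.a₁ * (t - s)) / Real.sinh (p.a₁ * (p.T - s)))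
    - p.a₀ / p.a₁

/-- The points of the domain in the non-monotone region below the critical trajectory, i.e. the
noiseless trajectory through `(d₁, t₂)`. -/
def sigma1 (t₂ : ℝ) : Set (ℝ × ℝ) :=
  {z | z ∈ p.domain ∩ p.nonmonotoneRegion ∧ z.1 < p.detPath p.d₁ t₂ z.2}

/-- The points of the domain in the non-monotone region on the critical trajectory. -/
def sigma2 (t₂ : ℝ) : Set (ℝ × ℝ) :=
  {z | z ∈ p.domain ∩ p.nonmonotoneRegion ∧ z.1 = p.detPath p.d₁ t₂ z.2}

/-- The rest of the domain. -/
def sigma3 (t₂ : ℝ) : Set (ℝ × ℝ) := p.domain \ (p.sigma1 t₂ ∪ p.sigma2 t₂)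

/-- The data after the reflection `x ↦ -x`, which exchanges `xT < d₁` and `xT > d₂`. -/
def reflect : OUData where
  a₀ := -p.a₀
  a₁ := p.a₁
  T := p.T
  xT := -p.xT
  d₁ := -p.d₂
  d₂ := -p.d₁

end OUData

/-- `q^ε(x, s) = 1 + o(ε^m)` as `ε ↓ 0` for every `m ≥ 0`, uniformly on compact subsets of `N`. -/
def EqOneUpToAllOrdersOn (q : ℝ → ℝ → ℝ → ℝ) (N : Set (ℝ × ℝ)) : Prop :=
  ∀ m : ℕ, ∀ K : Set (ℝ × ℝ), IsCompact K → K ⊆ N →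
    TendstoUniformlyOn (fun (ε : ℝ) (z : ℝ × ℝ) => (q ε z.1 z.2 - 1) / ε ^ m) (fun _ => 0)
      (𝓝[>] 0) K

end

/-! The asymptotics hold because `q` is exactly `1`: the bridge reaches `xT` at time `T` almost
surely, and if `xT ∉ D` then `T` itself is an exit time. The case distinctions enter only through
`xT ∉ D` and the inclusion of each region in the domain.

The terminal value is forced pathwise. Along a continuous path `y`, the drift times `T - u` tends to
`xT - y T` (`tendsto_sub_mul_drift`). A nonzero limit would make the integrated drift diverge
logarithmically, whereas the equation writes it as path minus start minus noise, which is bounded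
(`path_terminal_eq`). -/

/-- A function behaving like `c / (T - u)` with `c > 0` near `T` cannot have integrals bounded above up
to `T`. -/
theorem false_of_tendsto_sub_mul_pos_of_integral_le {g : ℝ → ℝ} {s T c M : ℝ} (hsT : s < T)
    (hg : ContinuousOn g (Ico s T)) (hc : 0 < c)
    (hlim : Tendsto (fun u => (T - u) * g u) (𝓝[<] T) (𝓝 c))
    (hM : ∀ t ∈ Ico s T, ∫ u in s..t, g u ≤ M) : False := by
  have hev : ∀ᶠ u in 𝓝[<] T, c / 2 < (T - u) * g u := hlim.eventually (lt_mem_nhds (by linarith))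
  obtain ⟨l, hl, hlT⟩ := (mem_nhdsLT_iff_exists_Ioo_subset' hsT).1 hev
  -- Beyond `r` both the integrability of `g` and the lower bound `c / 2 / (T - u)` are available.
  obtain ⟨r, hr, hrT⟩ := exists_between (max_lt hsT hl)
  have hsr : s < r := (le_max_left _ _).trans_lt hr
  have hlr : l < r := (le_max_right _ _).trans_lt hr
  have hint : ∀ a ∈ Ico s T, ∀ b ∈ Ico s T, IntervalIntegrable g volume a b := fun a ha b hb =>
    (hg.mono ((ordConnected_Ico).uIcc_subset ha hb)).intervalIntegrable
  have hlower : ∀ t ∈ Ico r T,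
      (∫ u in s..r, g u) + c / 2 * Real.log ((T - r) / (T - t)) ≤ M := by
    intro t ht
    have hs : s ∈ Ico s T := ⟨le_rfl, hsT⟩
    have hr' : r ∈ Ico s T := ⟨hsr.le, hrT⟩
    have ht' : t ∈ Ico s T := ⟨hsr.le.trans ht.1, ht.2⟩
    have hpos : ∀ u ∈ Icc r t, 0 < T - u := fun u hu => sub_pos.2 (hu.2.trans_lt ht.2)
    have hval : ∫ u in r..t, c / 2 * (T - u)⁻¹ = c / 2 * Real.log ((T - r) / (T - t)) := by
      rw [intervalIntegral.integral_const_mul,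
        intervalIntegral.integral_comp_sub_left (fun v => v⁻¹) T,
        integral_inv_of_pos (hpos t ⟨ht.1, le_rfl⟩) (hpos r ⟨le_rfl, ht.1⟩)]
    have hle : ∫ u in r..t, c / 2 * (T - u)⁻¹ ≤ ∫ u in r..t, g u := by
      refine intervalIntegral.integral_mono_on ht.1 ?_ (hint r hr' t ht') fun u hu => ?_
      · refine ContinuousOn.intervalIntegrable fun u hu => ?_
        rw [uIcc_of_le ht.1] at hu
        exact (ContinuousAt.mul continuousAt_const
          (ContinuousAt.inv₀ (by fun_prop) (hpos u hu).ne')).continuousWithinAt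
      · have h : c / 2 < (T - u) * g u := hlT ⟨hlr.trans_le hu.1, hu.2.trans_lt ht.2⟩
        rw [← div_eq_mul_inv, div_le_iff₀ (hpos u hu)]
        linarith
    have hadd := intervalIntegral.integral_add_adjacent_intervals (hint s hs r hr') (hint r hr' t ht')
    linarith [hM t ht']
  have hlog : Tendsto (fun t => Real.log ((T - r) / (T - t))) (𝓝[<] T) atTop := by
    refine Real.tendsto_log_atTop.comp (Tendsto.const_mul_atTop (sub_pos.2 hrT) ?_)
    refine tendsto_inv_nhdsGT_zero.comp (tendsto_nhdsWithin_iff.2 ⟨?_, ?_⟩)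
    · have : Tendsto (fun t => T - t) (𝓝 T) (𝓝 (T - T)) := by
        exact (continuous_const.sub continuous_id).tendsto T
      rw [sub_self] at this
      exact this.mono_left nhdsWithin_le_nhds
    · filter_upwards [self_mem_nhdsWithin] with t ht using sub_pos.2 (mem_Iio.1 ht)
  have htop : Tendsto (fun t => (∫ u in s..r, g u) + c / 2 * Real.log ((T - r) / (T - t)))
      (𝓝[<] T) atTop :=
    tendsto_atTop_add_const_left _ _ (hlog.const_mul_atTop (half_pos hc))
  obtain ⟨t, hMt, ht⟩ := ((htop.eventually_gt_atTop M).and (Ico_mem_nhdsLT hrT)).exists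
  exact (hlower t ht).not_gt hMt

/-- If `g` behaves like `c / (T - u)` near `T` and its integrals up to `T` are bounded,
then `c = 0`. -/
theorem eq_zero_of_tendsto_sub_mul_of_abs_integral_le {g : ℝ → ℝ} {s T c M : ℝ} (hsT : s < T)
    (hg : ContinuousOn g (Ico s T))
    (hlim : Tendsto (fun u => (T - u) * g u) (𝓝[<] T) (𝓝 c))
    (hM : ∀ t ∈ Ico s T, |∫ u in s..t, g u| ≤ M) : c = 0 := by
  rcases lt_trichotomy c 0 with hc | hc | hc
  · refine (false_of_tendsto_sub_mul_pos_of_integral_le (g := fun u => -g u) (M := M) hsT hg.neg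
      (neg_pos.2 hc) (by simpa using hlim.neg) fun t ht => ?_).elim
    rw [intervalIntegral.integral_neg]
    exact (neg_le_abs _).trans (hM t ht)
  · exact hc
  · exact (false_of_tendsto_sub_mul_pos_of_integral_le hsT hg hc hlim
      fun t ht => (le_abs_self _).trans (hM t ht)).elim

theorem Real.tendsto_div_sinh_nhdsNE_zero :
    Tendsto (fun v : ℝ => v / Real.sinh v) (𝓝[≠] 0) (𝓝 1) := by
  have h := hasDerivAt_iff_tendsto_slope_zero.1 (Real.hasDerivAt_sinh 0)
  simp only [zero_add, Real.sinh_zero, sub_zero, Real.cosh_zero, smul_eq_mul] at h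
  simpa [div_eq_mul_inv, mul_comm] using h.inv₀ one_ne_zero

namespace OUData

variable {p : OUData}

theorem continuousOn_drift (ha₁ : p.a₁ ≠ 0) {y : ℝ → ℝ} {s : ℝ}
    (hy : ContinuousOn y (Icc s p.T)) :
    ContinuousOn (fun u => p.drift (y u) u) (Ico s p.T) := by
  have hy' : ContinuousOn y (Ico s p.T) := hy.mono Ico_subset_Icc_self
  have hc : Continuous fun u => Real.cosh (p.a₁ * (p.T - u)) := by fun_prop
  have hs : Continuous fun u => Real.sinh (p.a₁ * (p.T - u)) := by fun_prop
  exact continuousOn_const.mul ((continuousOn_const.sub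
    ((hy'.add continuousOn_const).mul hc.continuousOn)).div hs.continuousOn fun u hu =>
      Real.sinh_ne_zero.2 (mul_ne_zero ha₁ (sub_pos.2 hu.2).ne'))

/-- The simple zero of `sinh` at `T` is cancelled by `T - u`; since `cosh` tends to `1`, the two
shifts by `a₀ / a₁` cancel in the limit. -/
theorem tendsto_sub_mul_drift (ha₁ : p.a₁ ≠ 0) {y : ℝ → ℝ} {z : ℝ}
    (hy : Tendsto y (𝓝[<] p.T) (𝓝 z)) :
    Tendsto (fun u => (p.T - u) * p.drift (y u) u) (𝓝[<] p.T) (𝓝 (p.xT - z)) := by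
  have harg : Tendsto (fun u => p.a₁ * (p.T - u)) (𝓝[<] p.T) (𝓝 0) := by
    have h : Continuous fun u => p.a₁ * (p.T - u) := by fun_prop
    have h' := h.tendsto p.T
    rw [sub_self, mul_zero] at h'
    exact h'.mono_left nhdsWithin_le_nhds
  have hne : Tendsto (fun u => p.a₁ * (p.T - u)) (𝓝[<] p.T) (𝓝[≠] 0) := by
    refine tendsto_nhdsWithin_iff.2 ⟨harg, ?_⟩
    filter_upwards [self_mem_nhdsWithin] with u hu
      using mul_ne_zero ha₁ (sub_pos.2 hu).ne'
  have hcosh : Tendsto (fun u => Real.cosh (p.a₁ * (p.T - u))) (𝓝[<] p.T) (𝓝 1) := by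
    simpa [Function.comp_def] using (Real.continuous_cosh.tendsto 0).comp harg
  have h := (Real.tendsto_div_sinh_nhdsNE_zero.comp hne).mul
    ((tendsto_const_nhds (x := p.xT + p.a₀ / p.a₁)).sub
      ((hy.add (tendsto_const_nhds (x := p.a₀ / p.a₁))).mul hcosh))
  have hz : 1 * (p.xT + p.a₀ / p.a₁ - (z + p.a₀ / p.a₁) * 1) = p.xT - z := by ring
  rw [hz] at h
  refine h.congr fun u => ?_
  simp only [Function.comp_apply, drift]
  ring

/-- A continuous path driven by the bridge drift plus a bounded perturbation ends at `xT`. -/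
theorem path_terminal_eq (ha₁ : p.a₁ ≠ 0) {x s : ℝ} (hs : s < p.T) {y n : ℝ → ℝ}
    (hy : ContinuousOn y (Icc s p.T)) (hn : ContinuousOn n (Icc s p.T))
    (heq : ∀ t ∈ Ico s p.T, y t = x + (∫ u in s..t, p.drift (y u) u) + n t) :
    y p.T = p.xT := by
  -- This function equals the drift integral only before `T`, but it is continuous on the closed
  -- interval, so compactness gives a bound uniform up to `T`.
  obtain ⟨M, hM⟩ := isCompact_Icc.exists_bound_of_continuousOn
    ((hy.sub continuousOn_const).sub hn : ContinuousOn (fun t => y t - x - n t) _)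
  have hlim : Tendsto y (𝓝[<] p.T) (𝓝 (y p.T)) := by
    have h : Tendsto y (𝓝[Icc s p.T] p.T) (𝓝 (y p.T)) := hy p.T ⟨hs.le, le_rfl⟩
    exact h.mono_left (nhdsWithin_le_of_mem
      (mem_of_superset (Ico_mem_nhdsLT hs) Ico_subset_Icc_self))
  refine (sub_eq_zero.1 (eq_zero_of_tendsto_sub_mul_of_abs_integral_le (M := M) hs
    (continuousOn_drift ha₁ hy) (tendsto_sub_mul_drift ha₁ hlim) fun t ht => ?_)).symm
  have h : ‖y t - x - n t‖ ≤ M := hM t (Ico_subset_Icc_self ht)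
  rwa [show y t - x - n t = ∫ u in s..t, p.drift (y u) u by rw [heq t ht]; ring,
    Real.norm_eq_abs] at h

/-- The Ornstein-Uhlenbeck bridge ends at `xT` almost surely. -/
theorem IsBridge.ae_terminal_eq (ha₁ : p.a₁ ≠ 0) {ε x s : ℝ} (hs : s < p.T)
    {Ω : Type*} [MeasurableSpace Ω] {P : Measure Ω} {W : ℝ≥0 → Ω → ℝ} {X : ℝ → Ω → ℝ}
    (h : p.IsBridge ε x s P W X) : ∀ᵐ ω ∂P, X p.T ω = p.xT := by
  filter_upwards [h.continuous_paths, h.sde, h.brownian.cont] with ω hc hsde hW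
  have hn : Continuous fun t : ℝ => √ε * (W t.toNNReal ω - W s.toNNReal ω) :=
    continuous_const.mul ((hW.comp continuous_real_toNNReal).sub continuous_const)
  exact path_terminal_eq ha₁ hs hc hn.continuousOn hsde

theorem IsBridge.exitProb_eq_one (ha₁ : p.a₁ ≠ 0) (hxT : p.xT ∉ p.D) {ε x s : ℝ} (hs : s < p.T)
    {Ω : Type*} [MeasurableSpace Ω] {P : Measure Ω} {W : ℝ≥0 → Ω → ℝ} {X : ℝ → Ω → ℝ}
    (h : p.IsBridge ε x s P W X) : p.exitProb s P X = 1 := by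
  have : IsProbabilityMeasure P :=
    (h.brownian.toIsPreBrownianReal.hasLaw_eval 0).isProbabilityMeasure
  have hae : {ω | p.exitTime s X ω ≤ (p.T : EReal)} =ᵐ[P] univ := by
    filter_upwards [h.ae_terminal_eq ha₁ hs] with ω hω
    refine eq_true (show p.exitTime s X ω ≤ (p.T : EReal) from ?_) |>.trans (eq_true (mem_univ ω)).symm
    exact sInf_le ⟨p.T, ⟨hs, le_rfl, hω ▸ hxT⟩, rfl⟩
  rw [exitProb, measureReal_congr hae, probReal_univ]

/-- The equation says that `cosh (a₁ (T - t))` equals a ratio strictly between `1` and `cosh (a₁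
T)`. Existence is the intermediate value theorem; uniqueness holds because `cosh` determines the
absolute value of its argument and `T - t > 0`. -/
theorem CaseAVIISubIII.existsUnique_isTangencyTime (ha₁ : p.a₁ ≠ 0) (hT : 0 < p.T)
    (h : p.CaseAVIISubIII) : ∃! t₂, p.IsTangencyTime t₂ := by
  obtain ⟨⟨hx, hd, hα⟩, hcosh⟩ := h
  rw [neg_div] at hα
  have hd₁ : 0 < p.d₁ + p.a₀ / p.a₁ := by linarith
  have hiff : ∀ t, p.d₁ + p.a₀ / p.a₁ = (p.xT + p.a₀ / p.a₁) / Real.cosh (p.a₁ * (p.T - t)) ↔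
      Real.cosh (p.a₁ * (p.T - t)) = (p.xT + p.a₀ / p.a₁) / (p.d₁ + p.a₀ / p.a₁) := fun t => by
    rw [eq_div_iff (Real.cosh_pos _).ne', eq_div_iff hd₁.ne', mul_comm]
  have hcont : ContinuousOn (fun t => Real.cosh (p.a₁ * (p.T - t))) (Icc 0 p.T) := by fun_prop
  have hmem : (p.xT + p.a₀ / p.a₁) / (p.d₁ + p.a₀ / p.a₁) ∈
      Ioo (Real.cosh (p.a₁ * (p.T - p.T))) (Real.cosh (p.a₁ * (p.T - 0))) := by
    rw [sub_self, mul_zero, Real.cosh_zero, sub_zero]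
    refine ⟨(one_lt_div hd₁).2 (by linarith), ?_⟩
    rw [div_lt_iff₀ hd₁]
    rw [gt_iff_lt, div_lt_iff₀ (Real.cosh_pos _)] at hcosh
    linarith
  obtain ⟨t, ht, hteq⟩ := intermediate_value_Ioo' hT.le hcont hmem
  refine ⟨t, ⟨ht, (hiff t).2 hteq⟩, fun t' ⟨ht', ht'eq⟩ => ?_⟩
  have heq : Real.cosh (p.a₁ * (p.T - t')) = Real.cosh (p.a₁ * (p.T - t)) :=
    ((hiff t').1 ht'eq).trans hteq.symm
  have habs := le_antisymm (Real.cosh_le_cosh.1 heq.le) (Real.cosh_le_cosh.1 heq.ge)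
  rw [abs_mul, abs_mul, abs_of_pos (sub_pos.2 ht.2), abs_of_pos (sub_pos.2 ht'.2)] at habs
  linarith [mul_left_cancel₀ (abs_ne_zero.2 ha₁) habs]

theorem CaseARegular.d₂_lt_xT (h : p.CaseARegular) : p.d₂ < p.xT := by
  rcases h with h | h | h | h | h | h | h | h
  · exact h.2.1
  · exact h.2.1
  · exact h.2.1.trans h.1
  · exact h.2.1 ▸ h.1
  · exact h.1
  · exact h.1
  · exact h.1.1
  · exact h.1.1

theorem sigma1_union_sigma3_subset_domain (t₂ : ℝ) : p.sigma1 t₂ ∪ p.sigma3 t₂ ⊆ p.domain :=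
  union_subset (fun _ hz => hz.1.1) sdiff_subset

theorem mem_domain_of_reflect {z : ℝ × ℝ} (hz : (-z.1, z.2) ∈ p.reflect.domain) :
    z ∈ p.domain := by
  obtain ⟨⟨h₁, h₂⟩, h₃⟩ := hz
  exact ⟨⟨neg_lt_neg_iff.1 h₂, neg_lt_neg_iff.1 h₁⟩, h₃⟩

end OUData

theorem eqOneUpToAllOrdersOn_of_eq_one {q : ℝ → ℝ → ℝ → ℝ} {N : Set (ℝ × ℝ)}
    (h : ∀ ε > 0, ∀ z ∈ N, q ε z.1 z.2 = 1) : EqOneUpToAllOrdersOn q N := by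
  intro m K _ hKN u hu
  filter_upwards [self_mem_nhdsWithin] with ε hε z hz
  simpa [h ε hε z (hKN hz)] using refl_mem_uniformity hu

theorem mainTheorem2 (p : OUData) (ha₁ : p.a₁ ≠ 0) (hT : 0 < p.T) (hd : p.d₁ < p.d₂)
    {Ω : ℝ → ℝ → ℝ → Type*} [∀ ε x s, MeasurableSpace (Ω ε x s)]
    (P : ∀ ε x s, Measure (Ω ε x s))
    (W : ∀ ε x s, ℝ≥0 → Ω ε x s → ℝ)
    (X : ∀ ε x s, ℝ → Ω ε x s → ℝ)
    (hX : ∀ ε > 0, ∀ x ∈ p.D, ∀ s ∈ Ico 0 p.T, p.IsBridge ε x s (P ε x s) (W ε x s) (X ε x s))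
    (q : ℝ → ℝ → ℝ → ℝ)
    (hq : ∀ ε > 0, ∀ x ∈ p.D, ∀ s ∈ Ico 0 p.T, q ε x s = p.exitProb s (P ε x s) (X ε x s)) :
    -- the case `xT > d₂`
    (p.CaseARegular → EqOneUpToAllOrdersOn q p.domain) ∧
    (p.CaseAVIISubIII → (∃! t₂, p.IsTangencyTime t₂) ∧
      ∀ t₂, p.IsTangencyTime t₂ → EqOneUpToAllOrdersOn q (p.sigma1 t₂ ∪ p.sigma3 t₂)) ∧
    -- the mirror image `xT < d₁`
    (p.reflect.CaseARegular → EqOneUpToAllOrdersOn q p.domain) ∧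
    (p.reflect.CaseAVIISubIII → (∃! t₂, p.reflect.IsTangencyTime t₂) ∧
      ∀ t₂, p.reflect.IsTangencyTime t₂ →
        EqOneUpToAllOrdersOn q
          {z | (-z.1, z.2) ∈ p.reflect.sigma1 t₂ ∪ p.reflect.sigma3 t₂}) ∧
    -- the identity `q = 1` whenever the bridge ends outside `D`
    (p.xT ∉ p.D → ∀ ε > 0, ∀ x ∈ p.D, ∀ s ∈ Ico 0 p.T, q ε x s = 1) := by
  have hone : p.xT ∉ p.D → ∀ ε > 0, ∀ x ∈ p.D, ∀ s ∈ Ico 0 p.T, q ε x s = 1 :=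
    fun hxT ε hε x hx s hs => (hq ε hε x hx s hs).trans
      ((hX ε hε x hx s hs).exitProb_eq_one ha₁ hxT hs.2)
  have hone' : p.xT ∉ p.D → ∀ N ⊆ p.domain, EqOneUpToAllOrdersOn q N := fun hxT N hN =>
    eqOneUpToAllOrdersOn_of_eq_one fun ε hε z hz =>
      hone hxT ε hε z.1 (hN hz).1 z.2 (hN hz).2
  have hright : p.d₂ < p.xT → p.xT ∉ p.D := fun h h' => h.not_gt h'.2
  -- Unfolded, the hypothesis reads `-d₁ < -xT`, so `xT` lies to the left of `D`; the process itself
  -- need not be reflected.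
  have hleft : p.reflect.d₂ < p.reflect.xT → p.xT ∉ p.D := fun h h' =>
    (neg_lt_neg_iff.1 h).not_gt h'.1
  exact ⟨fun h => hone' (hright h.d₂_lt_xT) _ subset_rfl,
    fun h => ⟨h.existsUnique_isTangencyTime ha₁ hT, fun t₂ _ =>
      hone' (hright h.1.1) _ (OUData.sigma1_union_sigma3_subset_domain t₂)⟩,
    fun h => hone' (hleft h.d₂_lt_xT) _ subset_rfl,
    fun h => ⟨h.existsUnique_isTangencyTime ha₁ hT, fun t₂ _ =>
      hone' (hleft h.1.1) _ fun _ hz => OUData.mem_domain_of_reflect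
        (OUData.sigma1_union_sigma3_subset_domain t₂ hz)⟩,
    hone⟩
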